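/- Let $n\in\mathbb N$, $T>0$, $q_0,q_T\in\mathbb R^n$, and let $V\in C^2(\mathbb R^n,\mathbb R)$ satisfy $C:=\sup_{q\in\mathbb R^n}|V''(q)|<\infty$ (operator norm of the Hessian). Let $\mathcal H=H^1_0([0,T],\mathbb R^n)$ with inner product $\langle c,h\rangle=\int_0^T\dot c(t)\cdot\dot h(t)\,dt$, and let $L:\mathcal H\to\mathbb R$ be the action $$L(c)=\int_0^T\Big(\tfrac12|\dot\gamma(t)|^2-V(\gamma(t))\Big)dt,\qquad \gamma(t)=q_0+\frac{t}{T}(q_T-q_0)+c(t).$$ For $k\ge1$ and $1\le j\le n$ put $\varphi_k^j(t)=\sqrt{2/T}\,\sin(k\pi t/T)\,e_j$, where $e_1,\dots,e_n$ is the standard basis of $\mathbb R^n$. For $N\in\mathbb N$ let $\mathcal U_N=\mathrm{span}\{\varphi_k^j:1\le k\le N,\ 1\le j\le n\}$, let $\mathcal V_N=\mathcal U_N^{\perp}$ be its orthogonal complement in $\mathcal H$, and let $\mathbb Q_N$ be the orthogonal projector of $\mathcal H$ onto $\mathcal V_N$. Suppose that $N\ge\lfloor T\sqrt C/\pi\rfloor$.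 Then $L$ is twice continuously Fréchet differentiable, $\mathcal U_N$ is finite-dimensional, and there is a continuously Fréchet differentiable map $\tilde v:\mathcal U_N\to\mathcal V_N$ such that for all $u\in\mathcal U_N$ and $v\in\mathcal V_N$ $$\mathbb Q_N\nabla L(u+v)=0\iff v=\tilde v(u),$$ and, equivalently, $\langle\nabla L(u+v),\delta v\rangle=0$ for all $\delta v\in\mathcal V_N$ if and only if $v=\tilde v(u)$. Moreover, the reduced action $S:\mathcal U_N\to\mathbb R$, $S(u)=L(u+\tilde v(u))$, is $C^1$, and the critical points of $L$ are exactly the curves $u+\tilde v(u)$ with $u$ a critical point of $S$: for every $c\in\mathcal H$, $\nabla L(c)=0$ if and only if $c=u+\tilde v(u)$ for some $u\in\mathcal U_N$ with $\nabla S(u)=0$. -/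

import Mathlib

open MeasureTheory Set
open scoped Gradient RealInnerProductSpace ContDiff

noncomputable section

namespace ExactReduction

/-- Euclidean space `ℝⁿ`. -/
abbrev E (n : ℕ) : Type := EuclideanSpace ℝ (Fin n)

/-- The space `L²([0,T], ℝⁿ)`. -/
abbrev L2 (n : ℕ) (T : ℝ) : Type := Lp (E n) 2 (volume.restrict (Ioc (0 : ℝ) T))

variable {n : ℕ} {T : ℝ}

theorem L2.integrable (g : L2 n T) : Integrable g (volume.restrict (Ioc (0 : ℝ) T)) :=
  (Lp.memLp g).integrable (by norm_num)

theorem L2.intervalIntegrable (g : L2 n T) {t : ℝ} (ht : t ∈ Icc (0 : ℝ) T) :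
    IntervalIntegrable g volume 0 t := by
  rw [intervalIntegrable_iff_integrableOn_Ioc_of_le ht.1]
  exact IntegrableOn.mono_set (t := Ioc 0 T) (L2.integrable g) (Ioc_subset_Ioc_right ht.2)

theorem L2.integral_congr {f g : ℝ → E n} (h : f =ᵐ[volume.restrict (Ioc (0 : ℝ) T)] g)
    {t : ℝ} (ht : t ∈ Icc (0 : ℝ) T) : ∫ s in (0 : ℝ)..t, f s = ∫ s in (0 : ℝ)..t, g s := by
  rw [intervalIntegral.integral_of_le ht.1, intervalIntegral.integral_of_le ht.1]
  exact integral_congr_ae (ae_restrict_of_ae_restrict_of_subset (Ioc_subset_Ioc_right ht.2) h)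

/-- The pairs `(c, ċ)` where `c : [0,T] → ℝⁿ` is an absolutely continuous curve (a primitive of its
derivative `ċ`) with `ċ ∈ L²([0,T], ℝⁿ)` and `c(0) = c(T) = 0`.  The curve is extended by zero
outside `[0,T]`. -/
def curveSubmodule (n : ℕ) (T : ℝ) : Submodule ℝ ((ℝ → E n) × L2 n T) where
  carrier := {p | (∀ t, t ∉ Ioo (0 : ℝ) T → p.1 t = 0) ∧
    ∀ t ∈ Icc (0 : ℝ) T, p.1 t = ∫ s in (0 : ℝ)..t, p.2 s}
  zero_mem' := by
    refine ⟨fun _ _ => rfl, fun t ht => ?_⟩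
    have h := L2.integral_congr (Lp.coeFn_zero (E n) 2 (volume.restrict (Ioc (0 : ℝ) T))) ht
    simpa using h.symm
  add_mem' := by
    rintro p q ⟨hp, hp'⟩ ⟨hq, hq'⟩
    refine ⟨fun t ht => by simp [hp t ht, hq t ht], fun t ht => ?_⟩
    have h := L2.integral_congr (Lp.coeFn_add p.2 q.2) ht
    simp only [Pi.add_apply] at h
    rw [intervalIntegral.integral_add (L2.intervalIntegrable _ ht)
      (L2.intervalIntegrable _ ht)] at h
    simp only [Prod.fst_add, Prod.snd_add, Pi.add_apply]
    rw [h, hp' t ht, hq' t ht]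
  smul_mem' := by
    rintro a p ⟨hp, hp'⟩
    refine ⟨fun t ht => by simp [hp t ht], fun t ht => ?_⟩
    have h := L2.integral_congr (Lp.coeFn_smul a p.2) ht
    simp only [Pi.smul_apply] at h
    rw [intervalIntegral.integral_smul] at h
    simp only [Prod.smul_fst, Prod.smul_snd, Pi.smul_apply]
    rw [h, hp' t ht]

/-- The Sobolev space `H¹₀([0,T], ℝⁿ)`. -/
def H10 (n : ℕ) (T : ℝ) : Type := curveSubmodule n T

namespace H10

instance : AddCommGroup (H10 n T) := inferInstanceAs (AddCommGroup (curveSubmodule n T))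

instance : Module ℝ (H10 n T) := inferInstanceAs (Module ℝ (curveSubmodule n T))

/-- The curve `t ↦ c(t)`. -/
def curve (c : H10 n T) : ℝ → E n := c.1.1

/-- The derivative `ċ ∈ L²([0,T], ℝⁿ)`. -/
def vel : H10 n T →ₗ[ℝ] L2 n T :=
  (LinearMap.snd ℝ (ℝ → E n) (L2 n T)).comp (curveSubmodule n T).subtype

theorem curve_eq_zero (c : H10 n T) {t : ℝ} (ht : t ∉ Ioo (0 : ℝ) T) : c.curve t = 0 :=
  c.2.1 t ht

theorem curve_eq_integral (c : H10 n T) {t : ℝ} (ht : t ∈ Icc (0 : ℝ) T) :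
    c.curve t = ∫ s in (0 : ℝ)..t, vel c s :=
  c.2.2 t ht

theorem vel_injective : Function.Injective (vel : H10 n T →ₗ[ℝ] L2 n T) := by
  intro c d h
  refine Subtype.ext (Prod.ext (funext fun t => ?_) h)
  change c.curve t = d.curve t
  by_cases ht : t ∈ Ioo (0 : ℝ) T
  · rw [curve_eq_integral c (Ioo_subset_Icc_self ht), curve_eq_integral d (Ioo_subset_Icc_self ht),
      h]
  · rw [curve_eq_zero c ht, curve_eq_zero d ht]

instance : NormedAddCommGroup (H10 n T) :=
  NormedAddCommGroup.induced (H10 n T) (L2 n T) vel vel_injective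

/-- The Hilbert structure `⟪c, h⟫ = ∫₀ᵀ ċ(t) · ḣ(t) dt`. -/
instance : InnerProductSpace ℝ (H10 n T) where
  norm_smul_le a c := by
    change ‖vel (a • c)‖ ≤ ‖a‖ * ‖vel c‖
    rw [map_smul, norm_smul]
  inner c h := ⟪vel c, vel h⟫
  norm_sq_eq_re_inner c := norm_sq_eq_re_inner (𝕜 := ℝ) (vel c)
  conj_inner_symm c h := inner_conj_symm (𝕜 := ℝ) (vel c) (vel h)
  add_left c d h := by
    change ⟪vel (c + d), vel h⟫ = ⟪vel c, vel h⟫ + ⟪vel d, vel h⟫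
    rw [map_add, inner_add_left]
  smul_left c h a := by
    change ⟪vel (a • c), vel h⟫ = _ * ⟪vel c, vel h⟫
    rw [map_smul, inner_smul_left]

theorem isometry_vel : Isometry (vel : H10 n T →ₗ[ℝ] L2 n T) :=
  AddMonoidHomClass.isometry_of_norm vel fun _ => rfl

theorem range_vel :
    Set.range (vel : H10 n T →ₗ[ℝ] L2 n T) = {g | ∫ s in Ioc (0 : ℝ) T, g s = 0} := by
  ext g
  constructor
  · rintro ⟨c, rfl⟩
    rcases le_or_gt T 0 with hT | hT
    · simp [Ioc_eq_empty_of_le hT]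
    · have h := curve_eq_integral c (right_mem_Icc.2 hT.le)
      rw [curve_eq_zero c (by simp), intervalIntegral.integral_of_le hT.le] at h
      exact h.symm
  · intro hg
    classical
    refine ⟨⟨((Ioo (0 : ℝ) T).indicator fun t => ∫ s in (0 : ℝ)..t, g s, g),
      fun t ht => by simp [ht], fun t ht => ?_⟩, rfl⟩
    by_cases h : t ∈ Ioo (0 : ℝ) T
    · simp [h]
    · rcases eq_or_lt_of_le ht.1 with h0 | h0
      · subst h0; simp
      · have : t = T := le_antisymm ht.2 (not_lt.1 fun h' => h ⟨h0, h'⟩)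
        subst this
        have hg' : ∫ s in Ioc (0 : ℝ) t, g s = 0 := hg
        simp only [indicator_of_notMem h]
        rw [intervalIntegral.integral_of_le h0.le, hg']

instance : CompleteSpace (H10 n T) := by
  rw [completeSpace_iff_isComplete_range isometry_vel.isUniformInducing, range_vel]
  refine IsClosed.isComplete ?_
  have h : {g : L2 n T | ∫ s in Ioc (0 : ℝ) T, g s = 0} =
      ⋂ x : E n, {g : L2 n T | ⟪indicatorConstLp 2 MeasurableSet.univ
        (measure_ne_top (volume.restrict (Ioc (0 : ℝ) T)) univ) x, g⟫ = 0} := by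
    ext g
    simp only [mem_ofPred_eq, mem_iInter, L2.inner_indicatorConstLp_eq_inner_setIntegral,
      Measure.restrict_univ]
    exact ⟨fun h x => by rw [h, inner_zero_right], fun h => inner_self_eq_zero.1 (h _)⟩
  rw [h]
  exact isClosed_iInter fun x => isClosed_eq (by fun_prop) continuous_const

end H10

/-- The derivative `√(2/T) (kπ/T) cos(kπt/T) e_j` of `φ_k^j`. -/
def basisVel (n : ℕ) (T : ℝ) (k : ℕ) (j : Fin n) (t : ℝ) : E n :=
  (√(2 / T) * (k * Real.pi / T * Real.cos (k * Real.pi * t / T))) • EuclideanSpace.single j 1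

theorem continuous_basisVel (n : ℕ) (T : ℝ) (k : ℕ) (j : Fin n) :
    Continuous (basisVel n T k j) := by
  unfold basisVel
  fun_prop

theorem memLp_basisVel (n : ℕ) (T : ℝ) (k : ℕ) (j : Fin n) :
    MemLp (basisVel n T k j) 2 (volume.restrict (Ioc (0 : ℝ) T)) := by
  refine MemLp.of_bound (continuous_basisVel n T k j).aestronglyMeasurable
    (|√(2 / T)| * |k * Real.pi / T|) (Filter.Eventually.of_forall fun t => ?_)
  rw [basisVel, norm_smul, PiLp.norm_single, norm_one, mul_one, Real.norm_eq_abs,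
    abs_mul, abs_mul]
  have := Real.abs_cos_le_one (k * Real.pi * t / T)
  have := mul_le_of_le_one_right (abs_nonneg (k * Real.pi / T)) this
  gcongr

theorem integral_basisVel (n : ℕ) (T : ℝ) (k : ℕ) (j : Fin n) (t : ℝ) :
    ∫ s in (0 : ℝ)..t, basisVel n T k j s =
      (√(2 / T) * Real.sin (k * Real.pi * t / T)) • EuclideanSpace.single j (1 : ℝ) := by
  rw [intervalIntegral.integral_eq_sub_of_hasDerivAt
    (f := fun t => (√(2 / T) * Real.sin (k * Real.pi * t / T)) • EuclideanSpace.single j (1 : ℝ))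
    (fun s _ => ?_) ((continuous_basisVel n T k j).intervalIntegrable _ _)]
  · simp
  · have h1 : HasDerivAt (fun t : ℝ => k * Real.pi * t / T) (k * Real.pi / T) s := by
      simpa using ((hasDerivAt_id s).const_mul (k * Real.pi : ℝ)).div_const T
    have h2 := (h1.sin.const_mul √(2 / T)).smul_const
      (EuclideanSpace.single j (1 : ℝ) : E n)
    rw [basisVel, mul_comm (k * Real.pi / T)]
    exact h2

/-- The basis function `φ_k^j(t) = √(2/T) sin(kπt/T) e_j` for `t ∈ [0,T]`. -/
def basisFun (n : ℕ) (T : ℝ) (k : ℕ) (j : Fin n) : H10 n T :=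
  ⟨((Ioo (0 : ℝ) T).indicator fun t =>
      (√(2 / T) * Real.sin (k * Real.pi * t / T)) • EuclideanSpace.single j (1 : ℝ),
    (memLp_basisVel n T k j).toLp (basisVel n T k j)), by
    refine ⟨fun t ht => by simp [ht], fun t ht => ?_⟩
    rw [L2.integral_congr (MemLp.coeFn_toLp (memLp_basisVel n T k j)) ht, integral_basisVel]
    by_cases h : t ∈ Ioo (0 : ℝ) T
    · simp [h]
    · simp only [indicator_of_notMem h]
      rcases eq_or_lt_of_le ht.1 with h0 | h0
      · simp [← h0]
      · have : t = T := le_antisymm ht.2 (not_lt.1 fun h' => h ⟨h0, h'⟩)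
        subst this
        rw [mul_div_assoc, div_self h0.ne', mul_one, Real.sin_nat_mul_pi, mul_zero, zero_smul]⟩

/-- `U_N`, the span of the `φ_k^j` with `1 ≤ k ≤ N`. -/
abbrev U (n : ℕ) (T : ℝ) (N : ℕ) : Submodule ℝ (H10 n T) :=
  Submodule.span ℝ (Set.range fun p : Finset.Icc 1 N × Fin n => basisFun n T p.1 p.2)

instance (n : ℕ) (T : ℝ) (N : ℕ) : FiniteDimensional ℝ (U n T N) :=
  FiniteDimensional.span_of_finite ℝ (Set.finite_range _)

instance (n : ℕ) (T : ℝ) (N : ℕ) : CompleteSpace (U n T N) := FiniteDimensional.complete ℝ _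

/-- `V_N`, the orthogonal complement of `U_N` in `H¹₀`. -/
abbrev V (n : ℕ) (T : ℝ) (N : ℕ) : Submodule ℝ (H10 n T) := (U n T N)ᗮ

/-- The orthogonal projector of `H¹₀` onto `V_N`. -/
def Q (n : ℕ) (T : ℝ) (N : ℕ) : H10 n T →L[ℝ] V n T N := (V n T N).orthogonalProjectionOnto

/-- The mechanical Lagrangian `½|q̇|² - W(q)` with potential energy `W`. -/
def lagrangian (W : E n → ℝ) (q w : E n) : ℝ := 1 / 2 * ‖w‖ ^ 2 - W q

/-- The curve `ι(c)(t) = q₀ + (t/T)(q_T - q₀) + c(t)` from `q₀` to `q_T`. -/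
def iota (q₀ q₁ : E n) (c : H10 n T) (t : ℝ) : E n := q₀ + (t / T) • (q₁ - q₀) + c.curve t

/-- The derivative of the curve `ι(c)`. -/
def iotaVel (q₀ q₁ : E n) (c : H10 n T) (t : ℝ) : E n := (1 / T) • (q₁ - q₀) + H10.vel c t

/-- The action functional on `H¹₀([0,T], ℝⁿ)`. -/
def action (W : E n → ℝ) (q₀ q₁ : E n) (c : H10 n T) : ℝ :=
  ∫ t in (0 : ℝ)..T, lagrangian W (iota q₀ q₁ c t) (iotaVel q₀ q₁ c t)

/-- The reduced action `S(u) = L(u + ṽ(u))` on `U_N`. -/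
def reducedAction {N : ℕ} (W : E n → ℝ) (q₀ q₁ : E n) (v : U n T N → V n T N) (u : U n T N) : ℝ :=
  action W q₀ q₁ ((u : H10 n T) + (v u : H10 n T))

end ExactReduction

end

/-!
Up to an additive constant the action is `½‖c‖² - P(c)`, where `P(c) = ∫₀ᵀ W(ι(c)(t)) dt`: the cross
term between `ċ` and the constant velocity of the reference segment integrates to zero, because
`c(0) = c(T) = 0`. Hence `∇L(c) = c - ∇P(c)`, and for `c = u + v` with `u ∈ U_N`, `v ∈ V_N` the
projected equation `Q_N ∇L(u + v) = 0` is the fixed point equation `v = Q_N ∇P(u + v)`.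

Its right-hand side is a contraction in `v`. Since `W'` is `C`-Lipschitz, the Cauchy-Schwarz
inequality gives `|⟪∇P(c) - ∇P(c'), h⟫| ≤ C ‖c - c'‖_{L²} ‖h‖_{L²}`
(`abs_fderiv_potential_sub_le`), and on `V_N` the `L²` norm is at most `T / ((N + 1)π)` times the
`H¹₀` norm (`norm_toL2_le_of_mem_V`). The contraction constant is therefore
`C (T / ((N + 1)π))²`, which is less than `1` exactly when `N + 1 > T √C / π`.

The Poincaré inequality on `V_N` holds because the `φ_k^j` are orthogonal in `H¹₀` and in `L²`, with
ratio of squared norms `(T / (kπ))²`, and form, once normalized, a Hilbert basis of `H¹₀`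
(`sineBasis`). Completeness of this system amounts to the statement that an integrable function on
`[0,T]` orthogonal to all `cos(kπt/T)`, `k ≥ 0`, vanishes almost everywhere; this follows from the
Stone-Weierstrass theorem, as the span of these cosines is a point-separating algebra.

Smoothness of `P` is differentiation under the integral sign: evaluation at time `t` is a bounded
operator `H¹₀ → ℝⁿ` that depends continuously on `t`. Then `ṽ` exists by the Banach fixed point
theorem and is `C¹` by the implicit function theorem (`exists_contDiff_fixedPoint`). Finally
`∇L(u + ṽ(u)) ⟂ V_N`, so the derivative of `ṽ` drops out of the chain rule for
`S(u) = L(u + ṽ(u))`, and `∇S(u) = 0` if and only if `∇L(u + ṽ(u))` is also orthogonal to `U_N`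
(`exists_reduction`).
-/

noncomputable section

namespace ExactReduction

/-! ### Fixed points depending on a parameter and the abstract reduction -/

section Reduction

variable {H : Type*} [NormedAddCommGroup H] [InnerProductSpace ℝ H] [CompleteSpace H]

theorem contDiff_gradient {P : H → ℝ} (hP : ContDiff ℝ 2 P) : ContDiff ℝ 1 (∇ P) := by
  have h : ContDiff ℝ 1 (fderiv ℝ P) := hP.fderiv_right (by norm_num)
  exact (InnerProductSpace.toDual ℝ H).symm.toContinuousLinearEquiv.contDiff.comp h

theorem inner_gradient (P : H → ℝ) (c h : H) : ⟪∇ P c, h⟫ = fderiv ℝ P c h := by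
  rw [gradient, InnerProductSpace.toDual_symm_apply]

theorem gradient_quadratic_sub {L P : H → ℝ} (hP : Differentiable ℝ P) {a : ℝ}
    (hL : ∀ c, L c = 1 / 2 * ‖c‖ ^ 2 + a - P c) (c : H) : ∇ L c = c - ∇ P c := by
  have h1 : HasGradientAt P (∇ P c) c := (hP c).hasGradientAt
  rw [hasGradientAt_iff_hasFDerivAt] at h1
  have h2 := (((hasStrictFDerivAt_norm_sq c).hasFDerivAt.const_mul (1 / 2 : ℝ)).add_const a).sub h1
  refine HasGradientAt.gradient ?_
  rw [hasGradientAt_iff_hasFDerivAt, funext hL]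
  refine h2.congr_fderiv ?_
  ext h
  simp

/-- The fixed point of a `C^m` family of uniform contractions is a `C^m` function of the
parameter. -/
theorem exists_contDiff_fixedPoint {X Y : Type*}
    [NormedAddCommGroup X] [NormedSpace ℝ X] [CompleteSpace X]
    [NormedAddCommGroup Y] [NormedSpace ℝ Y] [CompleteSpace Y] {f : X × Y → Y} {m : ℕ∞ω}
    (hm : m ≠ 0) (hf : ContDiff ℝ m f)
    {θ : NNReal} (hθ : θ < 1) (hlip : ∀ x, LipschitzWith θ fun y => f (x, y)) :
    ∃ g : X → Y, ContDiff ℝ m g ∧ ∀ x y, f (x, y) = y ↔ y = g x := by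
  have hc : ∀ x, ContractingWith θ fun y => f (x, y) := fun x => ⟨hθ, hlip x⟩
  have key : ∀ x y, f (x, y) = y ↔ y = ContractingWith.fixedPoint _ (hc x) := fun x y =>
    ⟨fun h => (hc x).fixedPoint_unique h, fun h => h ▸ (hc x).fixedPoint_isFixedPt⟩
  refine ⟨fun x => ContractingWith.fixedPoint _ (hc x), ?_, key⟩
  rw [contDiff_iff_contDiffAt]
  intro x
  set y := ContractingWith.fixedPoint _ (hc x) with hy
  have hF : ContDiffAt ℝ m (fun p : X × Y => p.2 - f p) (x, y) :=
    (contDiff_snd.sub hf).contDiffAt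
  have hfd : HasFDerivAt f (fderiv ℝ f (x, y)) (x, y) :=
    (hf.differentiable hm).differentiableAt.hasFDerivAt
  have hpart : HasFDerivAt (fun y' => f (x, y')) (fderiv ℝ f (x, y) ∘L .inr ℝ X Y) y :=
    hfd.comp y (hasFDerivAt_prodMk_right x y)
  -- The Lipschitz bound controls the partial derivative, so `1 - ∂f/∂y` is invertible.
  have hnorm : ‖fderiv ℝ f (x, y) ∘L .inr ℝ X Y‖ < 1 :=
    (hpart.le_of_lipschitz (hlip x)).trans_lt (by exact_mod_cast hθ)
  have hinv : (fderiv ℝ (fun p : X × Y => p.2 - f p) (x, y) ∘L .inr ℝ X Y).IsInvertible := by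
    have h1 : fderiv ℝ (fun p : X × Y => p.2 - f p) (x, y) =
        .snd ℝ X Y - fderiv ℝ f (x, y) := (hasFDerivAt_snd.sub hfd).fderiv
    have h2 : fderiv ℝ (fun p : X × Y => p.2 - f p) (x, y) ∘L .inr ℝ X Y =
        1 - fderiv ℝ f (x, y) ∘L .inr ℝ X Y := by
      rw [h1]; ext; simp
    rw [h2]
    obtain ⟨e, he⟩ := isUnit_one_sub_of_norm_lt_one hnorm
    exact ⟨ContinuousLinearEquiv.ofUnit e, he⟩
  -- Fixed points are unique, so the local implicit function is the fixed point near `x`.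
  refine (hF.contDiffAt_implicitFunction hm hinv).congr_of_eventuallyEq ?_
  filter_upwards [hF.eventually_apply_implicitFunction hm hinv] with z hz
  have h0 : y - f (x, y) = 0 := sub_eq_zero.2 ((key x y).2 hy).symm
  rw [h0, sub_eq_zero] at hz
  exact ((key z _).1 hz.symm).symm

/-- Lyapunov-Schmidt reduction of `L(c) = ½‖c‖² + a - P(c)` to a subspace `U`, when `∇P`, projected
to `Uᗮ`, is a contraction along `Uᗮ`. -/
theorem exists_reduction (U : Submodule ℝ H) [CompleteSpace U] {L P : H → ℝ}
    (hP : ContDiff ℝ 2 P) {a : ℝ} (hL : ∀ c, L c = 1 / 2 * ‖c‖ ^ 2 + a - P c)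
    {θ : NNReal} (hθ : θ < 1)
    (hlip : ∀ c c', c - c' ∈ Uᗮ → ∀ w ∈ Uᗮ,
      |fderiv ℝ P c w - fderiv ℝ P c' w| ≤ θ * ‖c - c'‖ * ‖w‖) :
    ContDiff ℝ 2 L ∧ ∃ vt : U → Uᗮ,
      ContDiff ℝ 1 vt ∧
      (∀ (u : U) (v : Uᗮ),
        Uᗮ.orthogonalProjectionOnto (∇ L ((u : H) + (v : H))) = 0 ↔ v = vt u) ∧
      (∀ (u : U) (v : Uᗮ),
        (∀ w : Uᗮ, ⟪∇ L ((u : H) + (v : H)), (w : H)⟫ = 0) ↔ v = vt u) ∧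
      ContDiff ℝ 1 (fun u : U => L ((u : H) + (vt u : H))) ∧
      ∀ c : H, ∇ L c = 0 ↔
          ∃ u : U, ∇ (fun u : U => L ((u : H) + (vt u : H))) u = 0 ∧
              c = (u : H) + (vt u : H) := by
  have hL2 : ContDiff ℝ 2 L := by
    rw [funext hL]
    exact ((contDiff_const.mul (contDiff_norm_sq ℝ)).add contDiff_const).sub hP
  refine ⟨hL2, ?_⟩
  have hgrad := gradient_quadratic_sub (hP.differentiable (by norm_num)) hL
  set Q := Uᗮ.orthogonalProjectionOnto
  have hQ : ∀ (x : H) (w : Uᗮ), ⟪Q x, w⟫ = ⟪x, (w : H)⟫ := fun x w => by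
    rw [Submodule.inner_orthogonalProjectionOnto_eq_of_mem_right]
  let f : U × Uᗮ → Uᗮ := fun p => Q (∇ P ((p.1 : H) + (p.2 : H)))
  have hf : ContDiff ℝ 1 f :=
    Q.contDiff.comp ((contDiff_gradient hP).comp
      ((U.subtypeL.contDiff.comp contDiff_fst).add (Uᗮ.subtypeL.contDiff.comp contDiff_snd)))
  have hflip : ∀ u, LipschitzWith θ fun v => f (u, v) := by
    refine fun u => LipschitzWith.of_dist_le_mul fun v v' => ?_
    rw [dist_eq_norm, dist_eq_norm]
    set z := f (u, v) - f (u, v') with hz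
    have h1 : ‖z‖ * ‖z‖ ≤ θ * ‖v - v'‖ * ‖z‖ := by
      have h2 := hlip (u + v) (u + v') (by simpa using (v - v').2) z z.2
      have h3 : ‖z‖ * ‖z‖ = fderiv ℝ P (u + v) z - fderiv ℝ P (u + v') z := by
        rw [← real_inner_self_eq_norm_mul_norm]
        nth_rw 1 [hz]
        rw [inner_sub_left, hQ, hQ, inner_gradient, inner_gradient]
      rw [h3]
      refine (le_abs_self _).trans (h2.trans_eq ?_)
      rw [add_sub_add_left_eq_sub]; rfl
    rcases (norm_nonneg z).eq_or_lt with h0 | h0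
    · rw [← h0]; positivity
    · exact le_of_mul_le_mul_right h1 h0
  obtain ⟨vt, hvt, hfix⟩ := exists_contDiff_fixedPoint one_ne_zero hf hθ hflip
  have hQL : ∀ (u : U) (v : Uᗮ), Q (∇ L ((u : H) + (v : H))) = v - f (u, v) := fun u v => by
    have h1 : Q (u : H) = 0 :=
      Submodule.orthogonalProjectionOnto_eq_zero_iff.2
        (Submodule.le_orthogonal_orthogonal U u.2)
    have h2 : Q (v : H) = v := Submodule.orthogonalProjectionOnto_mem_subspace_eq_self v
    rw [hgrad, map_sub, map_add, h1, h2, zero_add]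
  have hA : ∀ (u : U) (v : Uᗮ), Q (∇ L ((u : H) + (v : H))) = 0 ↔ v = vt u := fun u v => by
    rw [hQL, sub_eq_zero, ← hfix, eq_comm]
  have hB : ∀ (u : U) (v : Uᗮ),
      (∀ w : Uᗮ, ⟪∇ L ((u : H) + (v : H)), (w : H)⟫ = 0) ↔ v = vt u := fun u v => by
    rw [← hA]
    simp_rw [← hQ]
    exact ⟨fun h => inner_self_eq_zero.1 (h _), fun h w => by rw [h, inner_zero_left]⟩
  have hj : ContDiff ℝ 1 fun u : U => (u : H) + (vt u : H) :=
    U.subtypeL.contDiff.add (Uᗮ.subtypeL.contDiff.comp hvt)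
  have hS : ContDiff ℝ 1 (fun u : U => L ((u : H) + (vt u : H))) :=
    (hL2.of_le (by norm_num)).comp hj
  refine ⟨vt, hvt, hA, hB, hS, ?_⟩
  -- `∇ L` is orthogonal to the range of the derivative of `vt`.
  have hdS : ∀ u w : U,
      ⟪∇ (fun u : U => L ((u : H) + (vt u : H))) u, w⟫ =
        ⟪∇ L ((u : H) + (vt u : H)), (w : H)⟫ := fun u w => by
    have h1 : HasFDerivAt (fun u : U => (u : H) + (vt u : H))
        (U.subtypeL + Uᗮ.subtypeL ∘L fderiv ℝ vt u) u :=
      U.subtypeL.hasFDerivAt.add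
        (Uᗮ.subtypeL.hasFDerivAt.comp u ((hvt.differentiable one_ne_zero) u).hasFDerivAt)
    have h2 := ((hL2.differentiable two_ne_zero) ((u : H) + (vt u : H))).hasFDerivAt.comp u h1
    have h3 := h2.fderiv
    rw [inner_gradient, inner_gradient]
    have h4 : fderiv ℝ (fun u : U => L ((u : H) + (vt u : H))) u = _ := h3
    rw [h4]
    simp only [ContinuousLinearMap.comp_apply, add_apply, map_add,
      Submodule.subtypeL_apply]
    rw [← inner_gradient L _ (fderiv ℝ vt u w : H), (hB u (vt u)).2 rfl, add_zero]
  intro c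
  constructor
  · intro hc
    obtain ⟨u, hu, v, hv, rfl⟩ := Submodule.exists_add_mem_mem_orthogonal (K := U) c
    have h1 : (⟨v, hv⟩ : Uᗮ) = vt ⟨u, hu⟩ := (hA ⟨u, hu⟩ ⟨v, hv⟩).1 (by simp [hc])
    refine ⟨⟨u, hu⟩, ?_, by rw [← h1]⟩
    refine ext_inner_right ℝ fun w => ?_
    rw [hdS, ← h1]
    simp [hc]
  · rintro ⟨u, hu, rfl⟩
    refine ext_inner_right ℝ fun w => ?_
    obtain ⟨x, hx, y, hy, rfl⟩ := Submodule.exists_add_mem_mem_orthogonal (K := U) w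
    rw [inner_add_right, (hB u (vt u)).2 rfl ⟨y, hy⟩, ← hdS u ⟨x, hx⟩, hu]
    simp

end Reduction

/-! ### Differentiation of integrals depending on a parameter -/

section ParametricIntegral
open Filter Topology

variable {X G : Type*} [NormedAddCommGroup X] [NormedSpace ℝ X]
  [NormedAddCommGroup G] [NormedSpace ℝ G] {a b : ℝ} {F : X → ℝ → G} {F' : X → ℝ → X →L[ℝ] G}

/-- Differentiation under the integral sign over a compact interval. The parameter space need not
be locally compact: a bound for the derivative near `x`, uniform in `t`, comes from compactness of
the interval. -/
theorem hasFDerivAt_intervalIntegral_of_continuous (hF : Continuous F.uncurry)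
    (hF' : Continuous F'.uncurry) (hd : ∀ x t, HasFDerivAt (F · t) (F' x t) x) (x : X) :
    HasFDerivAt (fun x => ∫ t in a..b, F x t) (∫ t in a..b, F' x t) x := by
  obtain ⟨M, hM⟩ := (isCompact_uIcc (a := a) (b := b)).bddAbove_image
    (f := fun t => ‖F' x t‖) (hF'.comp (Continuous.prodMk_right x)).norm.continuousOn
  have hs : ∀ᶠ y in 𝓝 x, ∀ t ∈ uIcc a b, ‖F' y t‖ ≤ M + 1 := by
    refine isCompact_uIcc.eventually_forall_of_forall_eventually fun t ht => ?_
    have h1 : ‖F' x t‖ < M + 1 := (hM (mem_image_of_mem _ ht)).trans_lt (lt_add_one M)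
    exact (hF'.norm.continuousAt (x := (x, t))).eventually_le_const h1
  refine intervalIntegral.hasFDerivAt_integral_of_dominated_of_fderiv_le
    (bound := fun _ => M + 1) hs ?_ ?_ ?_ ?_ ?_ ?_
  · exact Eventually.of_forall fun y =>
      (hF.comp (Continuous.prodMk_right y)).aestronglyMeasurable
  · exact (hF.comp (Continuous.prodMk_right x)).intervalIntegrable _ _
  · exact (hF'.comp (Continuous.prodMk_right x)).aestronglyMeasurable
  · exact Eventually.of_forall fun t ht y hy => hy t (uIoc_subset_uIcc ht)
  · exact intervalIntegrable_const
  · exact Eventually.of_forall fun t _ y _ => hd y t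

theorem contDiff_one_intervalIntegral (hF : Continuous F.uncurry)
    (hF' : Continuous F'.uncurry) (hd : ∀ x t, HasFDerivAt (F · t) (F' x t) x) :
    ContDiff ℝ 1 fun x => ∫ t in a..b, F x t :=
  contDiff_one_iff_hasFDerivAt.2
    ⟨fun x => ∫ t in a..b, F' x t,
      intervalIntegral.continuous_parametric_intervalIntegral_of_continuous' hF' a b,
      hasFDerivAt_intervalIntegral_of_continuous hF hF' hd⟩

variable {Y : Type*} [NormedAddCommGroup Y] [NormedSpace ℝ Y] {W : Y → G}
  {β : ℝ → Y} {A : ℝ → X →L[ℝ] Y}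

theorem hasFDerivAt_intervalIntegral_comp_affine (hW : ContDiff ℝ 1 W) (hβ : Continuous β)
    (hA : Continuous A) (x : X) :
    HasFDerivAt (fun x => ∫ t in a..b, W (β t + A t x))
      (∫ t in a..b, fderiv ℝ W (β t + A t x) ∘L A t) x := by
  have h1 := hW.continuous
  have h2 := hW.continuous_fderiv one_ne_zero
  refine hasFDerivAt_intervalIntegral_of_continuous (F := fun x t => W (β t + A t x))
    (F' := fun x t => fderiv ℝ W (β t + A t x) ∘L A t) (by fun_prop) (by fun_prop) ?_ x
  intro x t
  exact ((hW.differentiable one_ne_zero) _).hasFDerivAt.comp x ((A t).hasFDerivAt.const_add (β t))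

/-- The integral functional of a `C²` function along a family of affine maps depending continuously
on `t` is `C²`. Only the derivative of `W` has to be differentiated again, followed by the linear
map of composition with `A t`. -/
theorem contDiff_two_intervalIntegral_comp_affine (hW : ContDiff ℝ 2 W) (hβ : Continuous β)
    (hA : Continuous A) : ContDiff ℝ 2 fun x => ∫ t in a..b, W (β t + A t x) := by
  have hW1 : ContDiff ℝ 1 W := hW.of_le one_le_two
  have hW' : ContDiff ℝ 1 (fderiv ℝ W) := hW.fderiv_right (by norm_num)
  rw [show (2 : ℕ∞ω) = (1 : ℕ) + 1 by norm_num, contDiff_succ_iff_hasFDerivAt, Nat.cast_one]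
  refine ⟨fun x => ∫ t in a..b, fderiv ℝ W (β t + A t x) ∘L A t, ?_,
    hasFDerivAt_intervalIntegral_comp_affine hW1 hβ hA⟩
  have h1 := hW'.continuous
  have h2 := hW'.continuous_fderiv one_ne_zero
  refine contDiff_one_intervalIntegral
    (F := fun x t => fderiv ℝ W (β t + A t x) ∘L A t)
    (F' := fun x t => (ContinuousLinearMap.compL ℝ X Y G).flip (A t) ∘L
      fderiv ℝ (fderiv ℝ W) (β t + A t x) ∘L A t) (by fun_prop) (by fun_prop) ?_
  intro x t
  have h3 : HasFDerivAt (fun x => fderiv ℝ W (β t + A t x))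
      (fderiv ℝ (fderiv ℝ W) (β t + A t x) ∘L A t) x :=
    ((hW'.differentiable one_ne_zero) _).hasFDerivAt.comp x ((A t).hasFDerivAt.const_add (β t))
  exact ((ContinuousLinearMap.compL ℝ X Y G).flip (A t)).hasFDerivAt.comp x h3

end ParametricIntegral

/-! ### Evaluation and the embedding into `L²` -/

theorem continuous_clm_of_norm_sub_le {X Y : Type*} [NormedAddCommGroup X] [NormedSpace ℝ X]
    [NormedAddCommGroup Y] [NormedSpace ℝ Y] {A : ℝ → X →L[ℝ] Y}
    (hA : ∀ s t x, ‖A t x - A s x‖ ≤ √|t - s| * ‖x‖) : Continuous A := by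
  rw [continuous_iff_continuousAt]
  intro s
  rw [ContinuousAt, tendsto_iff_norm_sub_tendsto_zero]
  refine squeeze_zero (g := fun t => √|t - s|) (fun _ => norm_nonneg _) (fun t => ?_) ?_
  · exact ContinuousLinearMap.opNorm_le_bound _ (Real.sqrt_nonneg _) (hA s t)
  · have : Continuous fun t : ℝ => √|t - s| := by fun_prop
    simpa using this.tendsto s

namespace H10
variable {n : ℕ} {T : ℝ}

theorem norm_eq_norm_vel (c : H10 n T) : ‖c‖ = ‖vel c‖ := rfl

theorem inner_eq_inner_vel (c d : H10 n T) : ⟪c, d⟫ = ⟪vel c, vel d⟫ := rfl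

theorem curve_add (c d : H10 n T) (t : ℝ) : (c + d).curve t = c.curve t + d.curve t := rfl

theorem curve_smul (r : ℝ) (c : H10 n T) (t : ℝ) : (r • c).curve t = r • c.curve t := rfl

/-- The Cauchy-Schwarz inequality for the integral over a subinterval, obtained by testing `g`
against the constant `∫ g` on this subinterval. -/
theorem norm_setIntegral_le (g : L2 n T) {s t : ℝ} (hst : s ≤ t) :
    ‖∫ r in Ioc s t, g r ∂(volume.restrict (Ioc 0 T))‖ ≤ √(t - s) * ‖g‖ := by
  set x := ∫ r in Ioc s t, g r ∂(volume.restrict (Ioc 0 T))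
  have hμ : (volume.restrict (Ioc 0 T)) (Ioc s t) ≠ ⊤ := measure_ne_top _ _
  have h1 : ‖x‖ * ‖x‖ = ⟪indicatorConstLp 2 measurableSet_Ioc hμ x, g⟫ := by
    rw [L2.inner_indicatorConstLp_eq_inner_setIntegral, real_inner_self_eq_norm_mul_norm]
  have h2 : ‖indicatorConstLp 2 measurableSet_Ioc hμ x‖ ≤ √(t - s) * ‖x‖ := by
    rw [norm_indicatorConstLp (by norm_num) (by norm_num), mul_comm, Real.sqrt_eq_rpow,
      ENNReal.toReal_ofNat]
    gcongr
    rw [← Real.volume_real_Ioc_of_le hst]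
    exact ENNReal.toReal_mono (measure_Ioc_lt_top (μ := volume)).ne
      (Measure.restrict_apply_le (Ioc 0 T) (Ioc s t))
  have h3 := h1.trans_le ((real_inner_le_norm _ _).trans
    (mul_le_mul_of_nonneg_right h2 (norm_nonneg g)))
  rcases (norm_nonneg x).eq_or_lt with h0 | h0
  · rw [← h0]; positivity
  · refine le_of_mul_le_mul_right (h3.trans_eq ?_) h0
    ring

theorem norm_curve_sub_le_of_le (c : H10 n T) {s t : ℝ} (hs : s ∈ Icc 0 T) (ht : t ∈ Icc 0 T)
    (hst : s ≤ t) : ‖c.curve t - c.curve s‖ ≤ √(t - s) * ‖c‖ := by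
  rw [curve_eq_integral c hs, curve_eq_integral c ht,
    intervalIntegral.integral_interval_sub_left (L2.intervalIntegrable _ ht)
      (L2.intervalIntegrable _ hs), intervalIntegral.integral_of_le hst]
  have h := norm_setIntegral_le (vel c) hst
  rwa [Measure.restrict_restrict measurableSet_Ioc,
    inter_eq_left.2 (Ioc_subset_Ioc hs.1 ht.2)] at h

/-- The Hölder-`1/2` estimate, valid for all times because curves vanish outside `(0,T)`. -/
theorem norm_curve_sub_le (c : H10 n T) (s t : ℝ) :
    ‖c.curve t - c.curve s‖ ≤ √|t - s| * ‖c‖ := by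
  wlog hst : s ≤ t generalizing s t
  · rw [norm_sub_rev, abs_sub_comm]
    exact this t s (le_of_not_ge hst)
  rw [abs_of_nonneg (sub_nonneg.2 hst)]
  rcases le_total T 0 with hT | hT
  · rw [curve_eq_zero c (by simp [hT]), curve_eq_zero c (by simp [hT]), sub_zero, norm_zero]
    positivity
  -- Clamping to `[0,T]` does not change the value of the curve.
  have hproj : ∀ r, c.curve r = c.curve (projIcc 0 T hT r) := fun r => by
    rcases le_or_gt r 0 with h0 | h0
    · rw [projIcc_of_le_left hT h0, curve_eq_zero c (by simp [h0]), curve_eq_zero c (by simp)]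
    rcases le_or_gt T r with h1 | h1
    · rw [projIcc_of_right_le hT h1, curve_eq_zero c (by simp [h1]), curve_eq_zero c (by simp)]
    · rw [projIcc_of_mem hT ⟨h0.le, h1.le⟩]
  rw [hproj s, hproj t]
  refine (norm_curve_sub_le_of_le c (projIcc 0 T hT s).2 (projIcc 0 T hT t).2
    (monotone_projIcc hT hst)).trans ?_
  refine mul_le_mul_of_nonneg_right (Real.sqrt_le_sqrt ?_) (norm_nonneg c)
  have h := abs_projIcc_sub_projIcc (c := t) (d := s) hT
  rw [abs_of_nonneg (sub_nonneg.2 hst)] at h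
  exact (le_abs_self _).trans h

/-- Evaluation at time `t`, as a continuous linear map. -/
def eval (n : ℕ) (T : ℝ) (t : ℝ) : H10 n T →L[ℝ] E n :=
  LinearMap.mkContinuous
    { toFun := fun c => c.curve t
      map_add' := fun c d => curve_add c d t
      map_smul' := fun r c => curve_smul r c t } √|t| fun c => by
    have h := norm_curve_sub_le c 0 t
    rwa [curve_eq_zero c (t := 0) (by simp), sub_zero, sub_zero] at h

theorem continuous_eval : Continuous (eval n T) :=
  continuous_clm_of_norm_sub_le fun s t c => norm_curve_sub_le c s t

theorem continuous_curve (c : H10 n T) : Continuous c.curve :=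
  (continuous_eval (n := n) (T := T)).clm_apply continuous_const

theorem norm_curve_le (c : H10 n T) (t : ℝ) : ‖c.curve t‖ ≤ √T * ‖c‖ := by
  by_cases ht : t ∈ Ioo 0 T
  · have h := norm_curve_sub_le c 0 t
    rw [curve_eq_zero c (t := 0) (by simp), sub_zero, sub_zero, abs_of_pos ht.1] at h
    exact h.trans (by have := ht.2.le; gcongr)
  · rw [curve_eq_zero c ht, norm_zero]; positivity

theorem memLp_curve (c : H10 n T) : MemLp c.curve 2 (volume.restrict (Ioc (0 : ℝ) T)) :=
  MemLp.of_bound (continuous_curve c).aestronglyMeasurable (√T * ‖c‖)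
    (Filter.Eventually.of_forall (norm_curve_le c))

/-- The embedding of `H¹₀([0,T], ℝⁿ)` into `L²([0,T], ℝⁿ)`. -/
def toL2 (n : ℕ) (T : ℝ) : H10 n T →L[ℝ] L2 n T :=
  LinearMap.mkContinuous
    { toFun := fun c => (memLp_curve c).toLp c.curve
      map_add' := fun c d => MemLp.toLp_add (memLp_curve c) (memLp_curve d)
      map_smul' := fun r c => MemLp.toLp_const_smul r (memLp_curve c) }
    ((measureUnivNNReal (volume.restrict (Ioc (0 : ℝ) T)) : ℝ) ^ (2 : ENNReal).toReal⁻¹ * √T)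
    fun c => by
      rw [mul_assoc]
      refine Lp.norm_le_of_ae_bound (by positivity) ?_
      filter_upwards [(memLp_curve c).coeFn_toLp] with t ht
      exact (congrArg norm ht).trans_le (norm_curve_le c t)

theorem coeFn_toL2 (c : H10 n T) :
    toL2 n T c =ᵐ[volume.restrict (Ioc (0 : ℝ) T)] c.curve := (memLp_curve c).coeFn_toLp

theorem inner_toL2 (c d : H10 n T) :
    ⟪toL2 n T c, toL2 n T d⟫ = ∫ t in Ioc 0 T, ⟪c.curve t, d.curve t⟫ := by
  rw [L2.inner_def]
  refine integral_congr_ae ?_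
  filter_upwards [coeFn_toL2 c, coeFn_toL2 d] with t h1 h2
  rw [h1, h2]

theorem norm_toL2_eq (c : H10 n T) :
    (∫ t in Ioc 0 T, ‖c.curve t‖ ^ (2 : ℝ)) ^ (1 / 2 : ℝ) = ‖toL2 n T c‖ := by
  rw [← Real.sqrt_eq_rpow, norm_eq_sqrt_real_inner, inner_toL2]
  simp_rw [real_inner_self_eq_norm_sq, Real.rpow_two]

theorem setIntegral_norm_mul_norm_le (c d : H10 n T) :
    ∫ t in Ioc 0 T, ‖c.curve t‖ * ‖d.curve t‖ ≤ ‖toL2 n T c‖ * ‖toL2 n T d‖ := by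
  rw [← norm_toL2_eq, ← norm_toL2_eq]
  have h2 : ENNReal.ofReal 2 = 2 := by norm_num
  exact integral_mul_norm_le_Lp_mul_Lq Real.HolderConjugate.two_two
    (by rw [h2]; exact memLp_curve c) (by rw [h2]; exact memLp_curve d)

theorem setIntegral_vel_eq_zero (c : H10 n T) : ∫ t in Ioc 0 T, vel c t = 0 := by
  have h : vel c ∈ Set.range (vel : H10 n T →ₗ[ℝ] L2 n T) := ⟨c, rfl⟩
  rw [range_vel] at h
  exact h

theorem setIntegral_norm_vel_sq (c : H10 n T) : ∫ t in Ioc 0 T, ‖vel c t‖ ^ 2 = ‖c‖ ^ 2 := by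
  rw [norm_eq_norm_vel, ← real_inner_self_eq_norm_sq, L2.inner_def]
  simp_rw [real_inner_self_eq_norm_sq]

end H10

/-! ### The potential part of the action -/

section Action
open H10
variable {n : ℕ} {T : ℝ} (W : E n → ℝ) (q₀ q₁ : E n)

/-- The potential part `∫₀ᵀ W(ι(c)(t)) dt` of the action. -/
def potential (c : H10 n T) : ℝ := ∫ t in (0 : ℝ)..T, W (iota q₀ q₁ c t)

theorem continuous_iota (c : H10 n T) : Continuous (iota q₀ q₁ c) := by
  have := continuous_curve c
  unfold iota
  fun_prop

variable {W}

/-- The action is half the squared norm minus the potential part, up to the action of the free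
motion along the segment from `q₀` to `q₁`. -/
theorem action_eq (hT : 0 < T) (hW : Continuous W) (c : H10 n T) :
    action W q₀ q₁ c =
      1 / 2 * ‖c‖ ^ 2 + T * (1 / 2 * ‖(1 / T) • (q₁ - q₀)‖ ^ 2) - potential W q₀ q₁ c := by
  set k := (1 / T) • (q₁ - q₀) with hk
  have hint := L2.integrable (vel c)
  have h1 : Integrable (fun t => ⟪k, vel c t⟫) (volume.restrict (Ioc 0 T)) :=
    hint.const_inner k
  have h2 : Integrable (fun t => ‖vel c t‖ ^ 2) (volume.restrict (Ioc 0 T)) :=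
    (Lp.memLp (vel c)).integrable_norm_pow two_ne_zero
  have h3 : Integrable (fun t => W (iota q₀ q₁ c t)) (volume.restrict (Ioc 0 T)) :=
    (hW.comp (continuous_iota q₀ q₁ c)).integrableOn_Ioc
  have h4 : ∫ t in Ioc 0 T, ⟪k, vel c t⟫ = 0 := by
    rw [integral_inner hint, setIntegral_vel_eq_zero, inner_zero_right]
  have h5 : ∀ t, lagrangian W (iota q₀ q₁ c t) (iotaVel q₀ q₁ c t) =
      1 / 2 * ‖k‖ ^ 2 + ⟪k, vel c t⟫ + 1 / 2 * ‖vel c t‖ ^ 2 - W (iota q₀ q₁ c t) := fun t => by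
    rw [lagrangian, iotaVel, ← hk, norm_add_sq_real]
    ring
  rw [action, potential, intervalIntegral.integral_of_le hT.le,
    intervalIntegral.integral_of_le hT.le]
  simp_rw [h5]
  rw [integral_sub _ h3, integral_add _ (h2.const_mul _), integral_add _ h1, h4,
    integral_const_mul (1 / 2) fun t => ‖vel c t‖ ^ 2, setIntegral_norm_vel_sq]
  · simp [hT.le]; ring
  · exact integrable_const _
  · exact (integrable_const _).add h1
  · exact ((integrable_const _).add h1).add (h2.const_mul _)

theorem contDiff_potential (hW : ContDiff ℝ 2 W) :
    ContDiff ℝ 2 (potential (T := T) W q₀ q₁) :=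
  contDiff_two_intervalIntegral_comp_affine (β := fun t => q₀ + (t / T) • (q₁ - q₀)) hW
    (by fun_prop) continuous_eval

theorem fderiv_potential (hW : ContDiff ℝ 1 W) (c h : H10 n T) :
    fderiv ℝ (potential W q₀ q₁) c h =
      ∫ t in (0 : ℝ)..T, fderiv ℝ W (iota q₀ q₁ c t) (h.curve t) := by
  have h1 := hW.continuous_fderiv one_ne_zero
  have h2 := continuous_iota q₀ q₁ c
  have h3 := continuous_eval (n := n) (T := T)
  have h4 := (hasFDerivAt_intervalIntegral_comp_affine (a := 0) (b := T)
    (β := fun t => q₀ + (t / T) • (q₁ - q₀)) hW (by fun_prop) h3 c).fderiv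
  change fderiv ℝ (potential W q₀ q₁) c =
    ∫ t in (0 : ℝ)..T, fderiv ℝ W (iota q₀ q₁ c t) ∘L eval n T t at h4
  rw [h4, ContinuousLinearMap.intervalIntegral_apply]
  · rfl
  · exact Continuous.intervalIntegrable (by fun_prop) _ _

theorem abs_fderiv_potential_sub_le (hT : 0 ≤ T) (hW : ContDiff ℝ 1 W) {C : NNReal}
    (hC : LipschitzWith C (fderiv ℝ W)) (c c' h : H10 n T) :
    |fderiv ℝ (potential W q₀ q₁) c h - fderiv ℝ (potential W q₀ q₁) c' h| ≤
      C * (‖toL2 n T (c - c')‖ * ‖toL2 n T h‖) := by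
  have h1 := hW.continuous_fderiv one_ne_zero
  have h2 := continuous_iota q₀ q₁ c
  have h3 := continuous_iota q₀ q₁ c'
  have h4 := continuous_curve h
  have h5 := continuous_curve (c - c')
  rw [fderiv_potential q₀ q₁ hW, fderiv_potential q₀ q₁ hW, ← intervalIntegral.integral_sub
    (Continuous.intervalIntegrable (by fun_prop) _ _)
    (Continuous.intervalIntegrable (by fun_prop) _ _), intervalIntegral.integral_of_le hT]
  refine (abs_integral_le_integral_abs).trans ?_
  refine le_trans ?_ (mul_le_mul_of_nonneg_left (setIntegral_norm_mul_norm_le (c - c') h) C.2)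
  rw [← integral_const_mul]
  refine integral_mono (Continuous.integrableOn_Ioc (by fun_prop))
    (Continuous.integrableOn_Ioc (by fun_prop)) fun t => ?_
  have h6 : iota q₀ q₁ c t - iota q₀ q₁ c' t = (c - c').curve t := by
    rw [iota, iota, add_sub_add_left_eq_sub]; rfl
  dsimp only
  rw [← sub_apply, ← Real.norm_eq_abs, ← mul_assoc, ← h6]
  exact ContinuousLinearMap.le_of_opNorm_le _ (hC.norm_sub_le _ _) _

end Action

/-! ### Completeness and orthogonality of the cosines -/

section CosineSystem
variable {T : ℝ}

/-- The function `t ↦ cos(kπt/T)` on `[0,T]`. -/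
def cosMap (T : ℝ) (k : ℕ) : C(Icc (0 : ℝ) T, ℝ) where
  toFun t := Real.cos (k * Real.pi * t / T)

theorem cosMap_mul (T : ℝ) {k l : ℕ} (h : l ≤ k) :
    cosMap T k * cosMap T l =
      (1 / 2 : ℝ) • cosMap T (k - l) + (1 / 2 : ℝ) • cosMap T (k + l) := by
  ext t
  have h1 := Real.cos_sub (k * Real.pi * t / T) (l * Real.pi * t / T)
  have h2 := Real.cos_add (k * Real.pi * t / T) (l * Real.pi * t / T)
  rw [← sub_div, ← sub_mul, ← sub_mul] at h1
  rw [← add_div, ← add_mul, ← add_mul] at h2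
  simp only [cosMap, ContinuousMap.mul_apply, ContinuousMap.add_apply, ContinuousMap.smul_apply,
    ContinuousMap.coe_mk, Nat.cast_sub h, Nat.cast_add, smul_eq_mul, h1, h2]
  ring

/-- The algebra of trigonometric polynomials spanned by the cosines `t ↦ cos(kπt/T)`. -/
def cosAlgebra (T : ℝ) : Subalgebra ℝ C(Icc (0 : ℝ) T, ℝ) :=
  (Submodule.span ℝ (range (cosMap T))).toSubalgebra
    (Submodule.subset_span ⟨0, by ext; simp [cosMap]⟩) fun f g hf hg => by
      have hmul : ∀ k l, cosMap T k * cosMap T l ∈ Submodule.span ℝ (range (cosMap T)) := by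
        intro k l
        wlog h : l ≤ k generalizing k l
        · rw [mul_comm]; exact this l k (le_of_not_ge h)
        rw [cosMap_mul T h]
        exact add_mem (Submodule.smul_mem _ _ (Submodule.subset_span ⟨_, rfl⟩))
          (Submodule.smul_mem _ _ (Submodule.subset_span ⟨_, rfl⟩))
      have h := Submodule.mul_mem_mul hf hg
      rw [Submodule.span_mul_span] at h
      refine Submodule.span_le.2 ?_ h
      rintro _ ⟨_, ⟨k, rfl⟩, _, ⟨l, rfl⟩, rfl⟩
      exact hmul k l

theorem cosAlgebra_topologicalClosure (hT : 0 < T) : (cosAlgebra T).topologicalClosure = ⊤ := by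
  refine ContinuousMap.subalgebra_topologicalClosure_eq_top_of_separatesPoints _ ?_
  intro s t hst
  refine ⟨cosMap T 1, ⟨cosMap T 1, Submodule.subset_span ⟨1, rfl⟩, rfl⟩, fun h => hst ?_⟩
  have hmem : ∀ r : Icc (0 : ℝ) T, Real.pi * r / T ∈ Icc 0 Real.pi := fun r => by
    have h0 := r.2.1
    refine ⟨by positivity, ?_⟩
    rw [div_le_iff₀ hT]
    exact mul_le_mul_of_nonneg_left r.2.2 Real.pi_pos.le
  have h1 : Real.pi * s / T = Real.pi * t / T :=
    Real.injOn_cos (hmem s) (hmem t) (by simpa [cosMap] using h)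
  have h2 := Real.pi_pos.ne'
  field_simp at h1
  exact Subtype.ext h1

/-- The cosines `cos(kπt/T)`, `k ≥ 0`, are complete on `[0,T]`. -/
theorem ae_eq_zero_of_integral_cos_smul_eq_zero {G : Type*} [NormedAddCommGroup G]
    [NormedSpace ℝ G] [CompleteSpace G] (hT : 0 < T) {g : ℝ → G}
    (hg : Integrable g (volume.restrict (Ioc 0 T)))
    (h : ∀ k : ℕ, ∫ t in Ioc 0 T, Real.cos (k * Real.pi * t / T) • g t = 0) :
    g =ᵐ[volume.restrict (Ioc 0 T)] 0 := by
  have hint : ∀ f : C(Icc (0 : ℝ) T, ℝ),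
      Integrable (fun t => f (projIcc 0 T hT.le t) • g t) (volume.restrict (Ioc 0 T)) := fun f =>
    hg.bdd_smul ‖f‖ (f.continuous.comp continuous_projIcc).aestronglyMeasurable
      (Filter.Eventually.of_forall fun t => f.norm_coe_le_norm _)
  -- Pairing with `g` is continuous in the uniform norm and vanishes on a dense subalgebra.
  let Φ : C(Icc (0 : ℝ) T, ℝ) →L[ℝ] G := LinearMap.mkContinuous
    { toFun := fun f => ∫ t in Ioc 0 T, f (projIcc 0 T hT.le t) • g t
      map_add' := fun f₁ f₂ => by
        simp_rw [ContinuousMap.add_apply, add_smul]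
        exact integral_add (hint f₁) (hint f₂)
      map_smul' := fun r f => by
        simp_rw [ContinuousMap.smul_apply, smul_assoc]
        exact integral_smul r _ } (∫ t in Ioc 0 T, ‖g t‖) fun f => by
      refine (norm_integral_le_of_norm_le (hg.norm.mul_const ‖f‖)
        (Filter.Eventually.of_forall fun t => ?_)).trans_eq (integral_mul_const _ _)
      rw [norm_smul, mul_comm]
      exact mul_le_mul_of_nonneg_left (f.norm_coe_le_norm _) (norm_nonneg _)
  have hΦ : ∀ f : ℝ → ℝ, ∀ hf : Continuous f,
      Φ ⟨fun t => f t, by fun_prop⟩ = ∫ t in Ioc 0 T, f t • g t := fun f hf => by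
    refine setIntegral_congr_fun measurableSet_Ioc fun t ht => ?_
    simp [projIcc_of_mem hT.le (Ioc_subset_Icc_self ht)]
  have hcos : ∀ f ∈ cosAlgebra T, Φ f = 0 := fun f hf => by
    change f ∈ Submodule.span ℝ (range (cosMap T)) at hf
    refine (Submodule.span_le (p := LinearMap.ker Φ.toLinearMap)).2 ?_ hf
    rintro _ ⟨k, rfl⟩
    exact (hΦ (fun t => Real.cos (k * Real.pi * t / T)) (by fun_prop)).trans (h k)
  have hzero : ∀ f, Φ f = 0 := fun f => by
    have hf : f ∈ (cosAlgebra T).topologicalClosure := by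
      rw [cosAlgebra_topologicalClosure hT]; trivial
    exact closure_minimal (s := (cosAlgebra T : Set C(Icc (0 : ℝ) T, ℝ))) (t := {f | Φ f = 0})
      hcos (isClosed_eq Φ.continuous continuous_const) hf
  exact ae_eq_zero_of_integral_contDiff_smul_eq_zero hg.locallyIntegrable fun φ hφ _ =>
    (hΦ φ hφ.continuous).symm.trans (hzero _)

theorem integral_cos_int (hT : 0 < T) (m : ℤ) :
    ∫ t in Ioc 0 T, Real.cos (m * Real.pi * t / T) = if m = 0 then T else 0 := by
  rw [← intervalIntegral.integral_of_le hT.le]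
  split_ifs with hm
  · simp [hm]
  · have h0 : (m * Real.pi / T : ℝ) ≠ 0 := by
      have := Real.pi_ne_zero; have := hT.ne'; positivity
    have h1 : ∀ t : ℝ, m * Real.pi * t / T = m * Real.pi / T * t := fun t => by ring
    simp_rw [h1]
    rw [intervalIntegral.integral_comp_mul_left (fun x => Real.cos x) h0, integral_cos,
      div_mul_cancel₀ _ hT.ne', Real.sin_int_mul_pi]
    simp

theorem integral_cos_mul_cos (hT : 0 < T) {k l : ℕ} (hk : 1 ≤ k) :
    ∫ t in Ioc 0 T, Real.cos (k * Real.pi * t / T) * Real.cos (l * Real.pi * t / T) =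
      if k = l then T / 2 else 0 := by
  have h1 : ∀ t : ℝ, Real.cos (k * Real.pi * t / T) * Real.cos (l * Real.pi * t / T) =
      1 / 2 * Real.cos (((k - l : ℤ) : ℝ) * Real.pi * t / T) +
        1 / 2 * Real.cos (((k + l : ℤ) : ℝ) * Real.pi * t / T) := fun t => by
    push_cast
    rw [sub_mul, sub_mul, sub_div, Real.cos_sub, add_mul, add_mul, add_div, Real.cos_add]
    ring
  simp_rw [h1]
  rw [integral_add, integral_const_mul, integral_const_mul, integral_cos_int hT,
    integral_cos_int hT, if_neg (show (k + l : ℤ) ≠ 0 by omega)]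
  · rcases eq_or_ne k l with h | h
    · simp [h]; ring
    · rw [if_neg (by omega), if_neg h]; ring
  · exact Continuous.integrableOn_Ioc (by fun_prop)
  · exact Continuous.integrableOn_Ioc (by fun_prop)

theorem integral_sin_mul_sin (hT : 0 < T) {k l : ℕ} (hk : 1 ≤ k) :
    ∫ t in Ioc 0 T, Real.sin (k * Real.pi * t / T) * Real.sin (l * Real.pi * t / T) =
      if k = l then T / 2 else 0 := by
  have h1 : ∀ t : ℝ, Real.sin (k * Real.pi * t / T) * Real.sin (l * Real.pi * t / T) =
      1 / 2 * Real.cos (((k - l : ℤ) : ℝ) * Real.pi * t / T) -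
        1 / 2 * Real.cos (((k + l : ℤ) : ℝ) * Real.pi * t / T) := fun t => by
    push_cast
    rw [sub_mul, sub_mul, sub_div, Real.cos_sub, add_mul, add_mul, add_div, Real.cos_add]
    ring
  simp_rw [h1]
  rw [integral_sub, integral_const_mul, integral_const_mul, integral_cos_int hT,
    integral_cos_int hT, if_neg (show (k + l : ℤ) ≠ 0 by omega)]
  · rcases eq_or_ne k l with h | h
    · simp [h]; ring
    · rw [if_neg (by omega), if_neg h]; ring
  · exact Continuous.integrableOn_Ioc (by fun_prop)
  · exact Continuous.integrableOn_Ioc (by fun_prop)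

end CosineSystem

/-! ### The Poincaré inequality on `V_N` -/

/-- If `J† J` is diagonal in a Hilbert basis, with eigenvalues `ev i`, and `x` has no component along
the eigenvectors with `ev i > r`, then `‖J x‖² ≤ r ‖x‖²`. -/
theorem HilbertBasis.norm_map_sq_le {ι X Y : Type*} [NormedAddCommGroup X]
    [InnerProductSpace ℝ X] [CompleteSpace X] [NormedAddCommGroup Y] [InnerProductSpace ℝ Y]
    [CompleteSpace Y] (b : HilbertBasis ι ℝ X) (J : X →L[ℝ] Y) {ev : ι → ℝ}
    (hJ : ∀ i j, ⟪J (b i), J (b j)⟫ = ev i * ⟪b i, b j⟫) {r : ℝ} {x : X}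
    (hx : ∀ i, r < ev i → ⟪b i, x⟫ = 0) : ‖J x‖ ^ 2 ≤ r * ‖x‖ ^ 2 := by
  have h1 : ∀ i, ⟪J (b i), J x⟫ = ev i * ⟪b i, x⟫ := fun i => by
    have h2 : innerSL ℝ (J (b i)) ∘L J = ev i • innerSL ℝ (b i) := by
      refine ContinuousLinearMap.ext_on (s := range b) ?_ ?_
      · rw [Submodule.dense_iff_topologicalClosure_eq_top]; exact b.dense_span
      · rintro _ ⟨j, rfl⟩
        simpa using hJ i j
    simpa using DFunLike.congr_fun h2 x
  -- Compare the expansions of `⟪J† J x, x⟫` and `r * ⟪x, x⟫` term by term.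
  have h3 := b.hasSum_inner_mul_inner (J.adjoint (J x)) x
  have h4 := (b.hasSum_inner_mul_inner x x).mul_left r
  rw [ContinuousLinearMap.adjoint_inner_left, real_inner_self_eq_norm_sq] at h3
  rw [real_inner_self_eq_norm_sq] at h4
  refine hasSum_le (fun i => ?_) h3 h4
  rw [ContinuousLinearMap.adjoint_inner_left, real_inner_comm, h1, real_inner_comm (b i) x]
  by_cases hi : r < ev i
  · simp [hx i hi]
  · rw [mul_assoc]
    exact mul_le_mul_of_nonneg_right (not_lt.1 hi) (mul_self_nonneg _)

section Basis
open H10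
variable {n : ℕ} {T : ℝ}

theorem vel_basisFun (k : ℕ) (j : Fin n) :
    vel (basisFun n T k j) =ᵐ[volume.restrict (Ioc (0 : ℝ) T)] basisVel n T k j :=
  (memLp_basisVel n T k j).coeFn_toLp

theorem curve_basisFun {t : ℝ} (ht : t ∈ Ioc 0 T) (k : ℕ) (j : Fin n) :
    (basisFun n T k j).curve t =
      (√(2 / T) * Real.sin (k * Real.pi * t / T)) • EuclideanSpace.single j (1 : ℝ) := by
  rw [curve_eq_integral _ (Ioc_subset_Icc_self ht),
    L2.integral_congr (vel_basisFun k j) (Ioc_subset_Icc_self ht), integral_basisVel]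

theorem inner_basisFun_left (k : ℕ) (j : Fin n) (h : H10 n T) :
    ⟪basisFun n T k j, h⟫ = √(2 / T) * (k * Real.pi / T) *
      ⟪(EuclideanSpace.single j 1 : E n),
        ∫ t in Ioc 0 T, Real.cos (k * Real.pi * t / T) • vel h t⟫ := by
  rw [inner_eq_inner_vel, L2.inner_def, ← integral_inner, ← integral_const_mul]
  · refine integral_congr_ae ?_
    filter_upwards [vel_basisFun k j] with t ht
    rw [ht, basisVel, inner_smul_left, inner_smul_right]
    simp only [conj_trivial]
    ring
  · exact (L2.integrable (vel h)).bdd_smul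
      (φ := fun t => Real.cos (k * Real.pi * t / T)) 1 (Continuous.aestronglyMeasurable (by fun_prop))
      (Filter.Eventually.of_forall fun t => Real.abs_cos_le_one _)

theorem inner_basisFun (hT : 0 < T) {k : ℕ} (hk : 1 ≤ k) (l : ℕ) (i j : Fin n) :
    ⟪basisFun n T k i, basisFun n T l j⟫ =
      if k = l ∧ i = j then (k * Real.pi / T) ^ 2 else 0 := by
  have h1 : ∀ t, ⟪basisVel n T k i t, basisVel n T l j t⟫ =
      (2 / T * (k * Real.pi / T) * (l * Real.pi / T) * if i = j then 1 else 0) *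
        (Real.cos (k * Real.pi * t / T) * Real.cos (l * Real.pi * t / T)) := fun t => by
    have h2 := Real.mul_self_sqrt (show 0 ≤ 2 / T by positivity)
    rw [basisVel, basisVel, inner_smul_left, inner_smul_right]
    generalize √(2 / T) = s at h2 ⊢
    rw [← h2]
    simp only [conj_trivial, EuclideanSpace.inner_single_left, PiLp.single_apply]
    ring
  rw [inner_eq_inner_vel, L2.inner_def]
  calc _ = ∫ t in Ioc 0 T, ⟪basisVel n T k i t, basisVel n T l j t⟫ := by
        refine integral_congr_ae ?_
        filter_upwards [vel_basisFun k i, vel_basisFun l j] with t h3 h4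
        rw [h3, h4]
    _ = _ := by
        simp_rw [h1]
        rw [integral_const_mul, integral_cos_mul_cos hT hk]
        by_cases h5 : k = l <;> by_cases h6 : i = j <;> simp [h5, h6]
        field_simp

theorem inner_toL2_basisFun (hT : 0 < T) {k : ℕ} (hk : 1 ≤ k) (l : ℕ) (i j : Fin n) :
    ⟪toL2 n T (basisFun n T k i), toL2 n T (basisFun n T l j)⟫ =
      if k = l ∧ i = j then 1 else 0 := by
  rw [inner_toL2]
  calc _ = ∫ t in Ioc 0 T, (2 / T * if i = j then 1 else 0) *
        (Real.sin (k * Real.pi * t / T) * Real.sin (l * Real.pi * t / T)) := by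
        refine setIntegral_congr_fun measurableSet_Ioc fun t ht => ?_
        have h2 := Real.mul_self_sqrt (show 0 ≤ 2 / T by positivity)
        rw [curve_basisFun ht, curve_basisFun ht, inner_smul_left, inner_smul_right]
        generalize √(2 / T) = s at h2 ⊢
        rw [← h2]
        simp only [conj_trivial, EuclideanSpace.inner_single_left, PiLp.single_apply]
        ring
    _ = _ := by
        rw [integral_const_mul, integral_sin_mul_sin hT hk]
        by_cases h5 : k = l <;> by_cases h6 : i = j <;> simp [h5, h6, hT.ne']

/-- The basis functions `φ_{k+1}^j`, normalized in `H¹₀`. -/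
def unitBasisFun (n : ℕ) (T : ℝ) (p : ℕ × Fin n) : H10 n T :=
  (T / ((p.1 + 1 : ℕ) * Real.pi)) • basisFun n T (p.1 + 1) p.2

theorem orthonormal_unitBasisFun (hT : 0 < T) : Orthonormal ℝ (unitBasisFun n T) := by
  rw [orthonormal_iff_ite]
  rintro ⟨k, i⟩ ⟨l, j⟩
  simp only [unitBasisFun]
  rw [inner_smul_left, inner_smul_right, inner_basisFun hT (Nat.le_add_left 1 k)]
  simp only [conj_trivial, Prod.mk.injEq, Nat.add_right_cancel_iff]
  split_ifs with h
  · rw [h.1]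
    have := Real.pi_pos
    field_simp
  · ring

/-- The system `φ_k^j` is total: `ḣ` is orthogonal to `cos(kπt/T)` for `k ≥ 1` by assumption, and
for `k = 0` because `h(0) = h(T)`. -/
theorem eq_zero_of_inner_basisFun_eq_zero (hT : 0 < T) {h : H10 n T}
    (hh : ∀ (k : ℕ) (j : Fin n), ⟪basisFun n T (k + 1) j, h⟫ = 0) : h = 0 := by
  refine vel_injective ?_
  rw [map_zero]
  refine Lp.eq_zero_iff_ae_eq_zero.2
    (ae_eq_zero_of_integral_cos_smul_eq_zero hT (L2.integrable (vel h)) fun k => ?_)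
  rcases k with _ | k
  · simpa using setIntegral_vel_eq_zero h
  · ext j
    have h1 := hh k j
    have h2 : √(2 / T) * ((k + 1 : ℕ) * Real.pi / T) ≠ 0 := by
      have := Real.pi_pos; positivity
    rw [inner_basisFun_left, mul_eq_zero_iff_left h2, EuclideanSpace.inner_single_left] at h1
    simpa using h1

/-- The Hilbert basis of `H¹₀([0,T], ℝⁿ)` formed by the normalized basis functions. -/
def sineBasis (n : ℕ) (hT : 0 < T) : HilbertBasis (ℕ × Fin n) ℝ (H10 n T) :=
  HilbertBasis.mkOfOrthogonalEqBot (orthonormal_unitBasisFun hT) <| by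
    rw [Submodule.eq_bot_iff]
    intro h hh
    refine eq_zero_of_inner_basisFun_eq_zero hT fun k j => ?_
    have h1 : ⟪unitBasisFun n T (k, j), h⟫ = 0 := hh _ (Submodule.subset_span ⟨(k, j), rfl⟩)
    have h2 : T / ((k + 1 : ℕ) * Real.pi) ≠ 0 := by
      have := Real.pi_pos; positivity
    rw [unitBasisFun, inner_smul_left] at h1
    exact (mul_eq_zero_iff_left h2).1 h1

theorem coe_sineBasis (hT : 0 < T) : ⇑(sineBasis n hT) = unitBasisFun n T :=
  HilbertBasis.coe_mkOfOrthogonalEqBot _ _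

/-- The Poincaré inequality on `V_N`, with constant given by the first frequency not in `U_N`. -/
theorem norm_toL2_le_of_mem_V (hT : 0 < T) {N : ℕ} {h : H10 n T} (hh : h ∈ V n T N) :
    ‖toL2 n T h‖ ≤ T / ((N + 1 : ℕ) * Real.pi) * ‖h‖ := by
  have hpi := Real.pi_pos
  have hsq : ‖toL2 n T h‖ ^ 2 ≤ (T / ((N + 1 : ℕ) * Real.pi)) ^ 2 * ‖h‖ ^ 2 := by
    refine HilbertBasis.norm_map_sq_le (sineBasis n hT) (toL2 n T)
      (ev := fun p => (T / ((p.1 + 1 : ℕ) * Real.pi)) ^ 2) ?_ ?_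
    · rintro ⟨k, i⟩ ⟨l, j⟩
      rw [orthonormal_iff_ite.1 (sineBasis n hT).orthonormal, coe_sineBasis]
      simp only [unitBasisFun, map_smul]
      rw [inner_smul_left, inner_smul_right, inner_toL2_basisFun hT (Nat.le_add_left 1 k)]
      simp only [conj_trivial, Prod.mk.injEq, Nat.add_right_cancel_iff]
      split_ifs with h
      · rw [h.1]; ring
      · ring
    · rintro ⟨k, j⟩ hk
      have hkN : k + 1 ≤ N := by
        by_contra! hlt
        refine hk.not_ge ?_
        have : ((N + 1 : ℕ) : ℝ) ≤ ((k + 1 : ℕ) : ℝ) := by exact_mod_cast hlt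
        dsimp only
        gcongr
      have hmem : basisFun n T (k + 1) j ∈ U n T N :=
        Submodule.subset_span ⟨(⟨k + 1, Finset.mem_Icc.2 ⟨Nat.le_add_left 1 k, hkN⟩⟩, j), rfl⟩
      rw [coe_sineBasis, unitBasisFun, inner_smul_left, hh _ hmem, mul_zero]
  rw [← mul_pow] at hsq
  exact le_of_sq_le_sq hsq (by positivity)

end Basis

/-! ### The contraction constant -/

section Threshold
variable {n : ℕ} {T : ℝ}

theorem mul_sq_lt_one_of_floor_le (hT : 0 < T) {C : ℝ} (hC : 0 ≤ C) {N : ℕ}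
    (hN : ⌊T * √C / Real.pi⌋₊ ≤ N) : C * (T / ((N + 1 : ℕ) * Real.pi)) ^ 2 < 1 := by
  have hpi := Real.pi_pos
  have h1 : T * √C / Real.pi < (N + 1 : ℕ) :=
    (Nat.lt_succ_floor _).trans_le (by exact_mod_cast Nat.succ_le_succ hN)
  have h2 : √C * (T / ((N + 1 : ℕ) * Real.pi)) < 1 := by
    rw [div_lt_iff₀ hpi] at h1
    rw [mul_div_assoc', div_lt_one (by positivity), mul_comm √C]
    exact h1
  rw [← Real.sq_sqrt hC, ← mul_pow]
  exact pow_lt_one₀ (by positivity) h2 two_ne_zero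

theorem abs_fderiv_potential_sub_le_of_mem_V (hT : 0 < T) {W : E n → ℝ} (q₀ q₁ : E n)
    (hW : ContDiff ℝ 1 W) {C : NNReal} (hC : LipschitzWith C (fderiv ℝ W)) {N : ℕ}
    {c c' h : H10 n T} (hc : c - c' ∈ V n T N) (hh : h ∈ V n T N) :
    |fderiv ℝ (potential W q₀ q₁) c h - fderiv ℝ (potential W q₀ q₁) c' h| ≤
      C * (T / ((N + 1 : ℕ) * Real.pi)) ^ 2 * ‖c - c'‖ * ‖h‖ := by
  have hpi := Real.pi_pos
  refine (abs_fderiv_potential_sub_le q₀ q₁ hT.le hW hC c c' h).trans ?_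
  refine (mul_le_mul_of_nonneg_left (mul_le_mul (norm_toL2_le_of_mem_V hT hc)
    (norm_toL2_le_of_mem_V hT hh) (norm_nonneg _) (by positivity)) C.2).trans_eq ?_
  simp only [NNReal.val_eq_coe]
  ring

end Threshold

end ExactReduction

end

theorem proposition2 (n : ℕ) (T : ℝ) (hT : 0 < T) (q₀ q₁ : ExactReduction.E n)
    (W : ExactReduction.E n → ℝ) (hW : ContDiff ℝ 2 W) (C : ℝ)
    (hC : IsLUB (Set.range fun q => ‖fderiv ℝ (fderiv ℝ W) q‖) C)
    (N : ℕ) (hN : ⌊T * √C / Real.pi⌋₊ ≤ N) :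
    ContDiff ℝ 2 (ExactReduction.action (T := T) W q₀ q₁) ∧
    FiniteDimensional ℝ (ExactReduction.U n T N) ∧
    ∃ vt : ExactReduction.U n T N → ExactReduction.V n T N,
      ContDiff ℝ 1 vt ∧
      (∀ (u : ExactReduction.U n T N) (v : ExactReduction.V n T N),
        ExactReduction.Q n T N
          (∇ (ExactReduction.action W q₀ q₁) ((u : ExactReduction.H10 n T) + (v : ExactReduction.H10 n T))) = 0 ↔
            v = vt u) ∧
      (∀ (u : ExactReduction.U n T N) (v : ExactReduction.V n T N),
        (∀ w : ExactReduction.V n T N,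
          ⟪∇ (ExactReduction.action W q₀ q₁) ((u : ExactReduction.H10 n T) + (v : ExactReduction.H10 n T)),
            (w : ExactReduction.H10 n T)⟫ = 0) ↔ v = vt u) ∧
      ContDiff ℝ 1 (ExactReduction.reducedAction W q₀ q₁ vt) ∧
      ∀ c : ExactReduction.H10 n T,
        ∇ (ExactReduction.action W q₀ q₁) c = 0 ↔
          ∃ u : ExactReduction.U n T N,
            ∇ (ExactReduction.reducedAction W q₀ q₁ vt) u = 0 ∧
              c = (u : ExactReduction.H10 n T) + (vt u : ExactReduction.H10 n T) := by
  have hbound : ∀ q, ‖fderiv ℝ (fderiv ℝ W) q‖ ≤ C := fun q => hC.1 ⟨q, rfl⟩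
  have hC0 : 0 ≤ C := (norm_nonneg (fderiv ℝ (fderiv ℝ W) 0)).trans (hbound 0)
  have hlip : LipschitzWith ⟨C, hC0⟩ (fderiv ℝ W) :=
    lipschitzWith_of_nnnorm_fderiv_le
      ((hW.fderiv_right (m := 1) (by norm_num)).differentiable one_ne_zero) hbound
  obtain ⟨hL, vt, h⟩ := ExactReduction.exists_reduction (ExactReduction.U n T N)
    (ExactReduction.contDiff_potential q₀ q₁ hW)
    (ExactReduction.action_eq q₀ q₁ hT hW.continuous)
    (θ := ⟨C * (T / ((N + 1 : ℕ) * Real.pi)) ^ 2, by positivity⟩)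
    (ExactReduction.mul_sq_lt_one_of_floor_le hT hC0 hN)
    fun c c' hc w hw => ExactReduction.abs_fderiv_potential_sub_le_of_mem_V hT q₀ q₁
      (hW.of_le one_le_two) hlip hc hw
  exact ⟨hL, inferInstance, vt, h⟩
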